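/- Let $D\subset\mathbb R^3$ be a nonempty bounded open set (for instance a bounded Lipschitz domain), let $L^2(D)$ denote the real Hilbert space of square integrable vector fields $D\to\mathbb R^3$, and understand $\operatorname{curl}$ in the sense of distributions. Put $H(\operatorname{curl},D)=\{u\in L^2(D):\operatorname{curl}u\in L^2(D)\}$, with its graph norm, and let $H_0(\operatorname{curl},D)$ be the closure of $C_0^\infty(D)^3$ in it. Let $$D_{\min}=\{u\in H_0(\operatorname{curl},D):\ \operatorname{curl}u\in H_0(\operatorname{curl},D)\},\qquad D_2=\{u\in L^2(D):\ \operatorname{curl}\operatorname{curl}u=0\},$$ and let $T^0$ be the operator $T^0u=\operatorname{curl}\operatorname{curl}u$ in $L^2(D)$ with domain the subspace sum $D_{\min}+D_2$. A *curl operator* is a closed linear operator $R$ in $L^2(D)$ that extends $\operatorname{curl}$ defined on $C_0^\infty(D)^3$; the product $RR^*$ has domain $\{u\in\mathcal D(R^*):R^*u\in\mathcal D(R)\}$. 1. There is no curl operator $R$ with $T^0=R\,R^*$. 2. There is a field $u\in D_2$ with $u\notin H(\operatorname{curl},D)$, that is, $u\in L^2(D)$, $\operatorname{curl}\operatorname{curl}u=0$,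 but $\operatorname{curl}u\notin L^2(D)$. 3. Let $D$ be the open unit ball. In cylindrical coordinates $(r,\theta,z)$ the series $\sum_{n\ge1}r^n\sin(n\theta)$ converges at every point of $D$, and the field $u=\bigl(\sum_{n\ge1}r^n\sin(n\theta)\bigr)e_z$ belongs to $L^2(D)$ and to $D_2$, but not to $H(\operatorname{curl},D)$. -/

import Mathlib

open MeasureTheory TopologicalSpace
open scoped ContDiff

noncomputable section

namespace CurlCurl

/-- Euclidean three-space. -/
abbrev E3 : Type := EuclideanSpace ℝ (Fin 3)

/-- The `j`-th partial derivative of a scalar function. -/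
def pderiv (j : Fin 3) (f : E3 → ℝ) (x : E3) : ℝ :=
  fderiv ℝ f x (EuclideanSpace.single j 1)

/-- The classical curl of a vector field on three-space. -/
def vcurl (φ : E3 → E3) (x : E3) : E3 :=
  !₂[pderiv 1 (fun y => φ y 2) x - pderiv 2 (fun y => φ y 1) x,
     pderiv 2 (fun y => φ y 0) x - pderiv 0 (fun y => φ y 2) x,
     pderiv 0 (fun y => φ y 1) x - pderiv 1 (fun y => φ y 0) x]

/-- The smooth vector fields with compact support contained in `D`. -/
structure IsTestField (D : Opens E3) (φ : E3 → E3) : Prop where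
  smooth : ContDiff ℝ ∞ φ
  compact : HasCompactSupport φ
  support_subset : tsupport φ ⊆ (D : Set E3)

/-- The real Hilbert space of square integrable vector fields on `D`. -/
abbrev L2 (D : Opens E3) : Type := Lp E3 2 (volume.restrict (D : Set E3))

/-- `curl u = v` on `D` in the sense of distributions. -/
def IsWeakCurl (D : Opens E3) (u v : L2 D) : Prop :=
  ∀ φ : E3 → E3, IsTestField D φ →
    ∫ x in (D : Set E3), inner ℝ (u x) (vcurl φ x) = ∫ x in (D : Set E3), inner ℝ (v x) (φ x)

/-- `curl curl u = w` on `D` in the sense of distributions. -/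
def IsWeakCurlCurl (D : Opens E3) (u w : L2 D) : Prop :=
  ∀ φ : E3 → E3, IsTestField D φ →
    ∫ x in (D : Set E3), inner ℝ (u x) (vcurl (vcurl φ) x)
      = ∫ x in (D : Set E3), inner ℝ (w x) (φ x)

/-! ### Facts needed for the definitions below to make sense -/

lemma pderiv_contDiff {j : Fin 3} {f : E3 → ℝ} (hf : ContDiff ℝ ∞ f) :
    ContDiff ℝ ∞ (pderiv j f) := by
  have h : ContDiff ℝ ∞ (fderiv ℝ f) := hf.fderiv_right (by simp)
  exact h.clm_apply contDiff_const

lemma pderiv_add {j : Fin 3} {f g : E3 → ℝ} (hf : ContDiff ℝ ∞ f) (hg : ContDiff ℝ ∞ g) (x : E3) :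
    pderiv j (fun y => f y + g y) x = pderiv j f x + pderiv j g x := by
  have h := fderiv_fun_add (𝕜 := ℝ) (x := x) (hf.differentiable (by simp) x)
    (hg.differentiable (by simp) x)
  simp [pderiv, h]

lemma pderiv_const_mul {j : Fin 3} {f : E3 → ℝ} (c : ℝ) (hf : ContDiff ℝ ∞ f) (x : E3) :
    pderiv j (fun y => c * f y) x = c * pderiv j f x := by
  have h := fderiv_const_mul (𝕜 := ℝ) (x := x) (hf.differentiable (by simp) x) c
  simp [pderiv, h]

lemma comp_contDiff {φ : E3 → E3} (hφ : ContDiff ℝ ∞ φ) (i : Fin 3) :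
    ContDiff ℝ ∞ (fun y => φ y i) :=
  (contDiff_euclidean.1 hφ) i

lemma vcurl_contDiff {φ : E3 → E3} (hφ : ContDiff ℝ ∞ φ) : ContDiff ℝ ∞ (vcurl φ) := by
  rw [contDiff_euclidean]
  intro i
  fin_cases i <;>
    exact (pderiv_contDiff (comp_contDiff hφ _)).sub (pderiv_contDiff (comp_contDiff hφ _))

lemma vcurl_add {φ ψ : E3 → E3} (hφ : ContDiff ℝ ∞ φ) (hψ : ContDiff ℝ ∞ ψ) :
    vcurl (φ + ψ) = vcurl φ + vcurl ψ := by
  funext x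
  ext i
  have h : ∀ j k, pderiv j (fun y => (φ + ψ) y k) x
      = pderiv j (fun y => φ y k) x + pderiv j (fun y => ψ y k) x := fun j k =>
    pderiv_add (comp_contDiff hφ k) (comp_contDiff hψ k) x
  have e : ∀ χ : E3 → E3, (∀ j k, pderiv j (fun y => χ y k) x
      = pderiv j (fun y => φ y k) x + pderiv j (fun y => ψ y k) x) →
      vcurl χ x i = vcurl φ x i + vcurl ψ x i := by
    intro χ hχ
    fin_cases i <;> simp [vcurl, hχ] <;> ring
  exact e _ h

lemma vcurl_smul {φ : E3 → E3} (c : ℝ) (hφ : ContDiff ℝ ∞ φ) :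
    vcurl (c • φ) = c • vcurl φ := by
  funext x
  ext i
  have h : ∀ j k, pderiv j (fun y => (c • φ) y k) x
      = c * pderiv j (fun y => φ y k) x := fun j k =>
    pderiv_const_mul c (comp_contDiff hφ k) x
  have e : ∀ χ : E3 → E3, (∀ j k, pderiv j (fun y => χ y k) x
      = c * pderiv j (fun y => φ y k) x) → vcurl χ x i = c * vcurl φ x i := by
    intro χ hχ
    fin_cases i <;> simp [vcurl, hχ] <;> ring
  exact e _ h

lemma vcurl_tsupport (φ : E3 → E3) : tsupport (vcurl φ) ⊆ tsupport φ := by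
  apply closure_minimal _ (isClosed_tsupport φ)
  intro x hx
  by_contra hxs
  apply hx
  have h0 : φ =ᶠ[nhds x] 0 := notMem_tsupport_iff_eventuallyEq.1 hxs
  have h : ∀ j k, pderiv j (fun y => φ y k) x = 0 := by
    intro j k
    have h1 : (fun y => φ y k) =ᶠ[nhds x] fun _ => (0 : ℝ) := by
      filter_upwards [h0] with y hy
      simp [hy]
    simp [pderiv, h1.fderiv_eq]
  ext i
  fin_cases i <;> simp [vcurl, h]

lemma IsTestField.vcurl {D : Opens E3} {φ : E3 → E3} (h : IsTestField D φ) :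
    IsTestField D (vcurl φ) where
  smooth := vcurl_contDiff h.smooth
  compact := h.compact.mono' ((subset_tsupport _).trans (vcurl_tsupport φ))
  support_subset := (vcurl_tsupport φ).trans h.support_subset

lemma IsTestField.zero (D : Opens E3) : IsTestField D (0 : E3 → E3) where
  smooth := contDiff_const
  compact := HasCompactSupport.zero
  support_subset := by simp [tsupport]

lemma IsTestField.add {D : Opens E3} {φ ψ : E3 → E3} (h : IsTestField D φ)
    (h' : IsTestField D ψ) : IsTestField D (φ + ψ) where
  smooth := h.smooth.add h'.smooth
  compact := h.compact.add h'.compact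
  support_subset := (tsupport_add φ ψ).trans
    (Set.union_subset h.support_subset h'.support_subset)

lemma IsTestField.smul {D : Opens E3} {φ : E3 → E3} (c : ℝ) (h : IsTestField D φ) :
    IsTestField D (c • φ) where
  smooth := contDiff_const.smul h.smooth
  compact := h.compact.smul_left (f := fun _ => c)
  support_subset := (tsupport_smul_subset_right (fun _ => c) φ).trans h.support_subset

lemma IsTestField.memLp {D : Opens E3} {φ : E3 → E3} (h : IsTestField D φ) :
    MemLp φ 2 (volume.restrict (D : Set E3)) :=
  h.smooth.continuous.memLp_of_hasCompactSupport h.compact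

lemma IsTestField.integral_eq {D : Opens E3} {φ : E3 → E3} (h : IsTestField D φ) (u : L2 D) :
    ∫ x in (D : Set E3), inner ℝ (u x) (φ x) = inner ℝ u h.memLp.toLp := by
  rw [L2.inner_def]
  apply integral_congr_ae
  filter_upwards [h.memLp.coeFn_toLp] with x hx
  rw [hx]

lemma isWeakCurl_iff {D : Opens E3} {u v : L2 D} : IsWeakCurl D u v ↔
    ∀ φ : E3 → E3, ∀ h : IsTestField D φ,
      inner ℝ u h.vcurl.memLp.toLp = inner ℝ v h.memLp.toLp := by
  refine forall₂_congr fun φ h => ?_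
  rw [h.integral_eq, h.vcurl.integral_eq]

lemma isWeakCurlCurl_iff {D : Opens E3} {u w : L2 D} : IsWeakCurlCurl D u w ↔
    ∀ φ : E3 → E3, ∀ h : IsTestField D φ,
      inner ℝ u h.vcurl.vcurl.memLp.toLp = inner ℝ w h.memLp.toLp := by
  refine forall₂_congr fun φ h => ?_
  rw [h.integral_eq, h.vcurl.vcurl.integral_eq]

/-- Integration by parts for one partial derivative. -/
lemma integral_pderiv {D : Opens E3} {φ ψ : E3 → E3} (hφ : IsTestField D φ)
    (hψ : IsTestField D ψ) (i j k : Fin 3) :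
    ∫ x, φ x i * pderiv j (fun y => ψ y k) x = - ∫ x, pderiv j (fun y => φ y i) x * ψ x k := by
  have ci := comp_contDiff hφ.smooth i
  have ck := comp_contDiff hψ.smooth k
  have si : HasCompactSupport (fun y => φ y i) :=
    hφ.compact.comp_left (g := fun v : E3 => v i) rfl
  have sk : HasCompactSupport (fun y => ψ y k) :=
    hψ.compact.comp_left (g := fun v : E3 => v k) rfl
  refine integral_mul_fderiv_eq_neg_fderiv_mul_of_integrable ?_ ?_ ?_
    (fun x _ => ci.differentiable (by simp) x) (fun x _ => ck.differentiable (by simp) x)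
  · exact ((pderiv_contDiff ci).continuous.mul ck.continuous).integrable_of_hasCompactSupport
      (sk.mul_left (f := pderiv j fun y => φ y i))
  · exact (ci.continuous.mul (pderiv_contDiff ck).continuous).integrable_of_hasCompactSupport
      (si.mul_right (f' := pderiv j fun y => ψ y k))
  · exact (ci.continuous.mul ck.continuous).integrable_of_hasCompactSupport
      (sk.mul_left (f := fun y => φ y i))

lemma integrable_mul_pderiv {D : Opens E3} {φ ψ : E3 → E3} (hφ : IsTestField D φ)
    (hψ : IsTestField D ψ) (i j k : Fin 3) :
    Integrable (fun x => φ x i * pderiv j (fun y => ψ y k) x) := by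
  have ci := comp_contDiff hφ.smooth i
  have si : HasCompactSupport (fun y => φ y i) :=
    hφ.compact.comp_left (g := fun v : E3 => v i) rfl
  exact (ci.continuous.mul (pderiv_contDiff (comp_contDiff hψ.smooth k)).continuous
    ).integrable_of_hasCompactSupport (si.mul_right (f' := pderiv j fun y => ψ y k))

lemma integral_inner_vcurl {D : Opens E3} {φ ψ : E3 → E3} (hφ : IsTestField D φ)
    (hψ : IsTestField D ψ) :
    ∫ x, inner ℝ (φ x) (vcurl ψ x) =
      (∫ x, φ x 0 * pderiv 1 (fun y => ψ y 2) x) - (∫ x, φ x 0 * pderiv 2 (fun y => ψ y 1) x)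
      + ((∫ x, φ x 1 * pderiv 2 (fun y => ψ y 0) x) - ∫ x, φ x 1 * pderiv 0 (fun y => ψ y 2) x)
      + ((∫ x, φ x 2 * pderiv 0 (fun y => ψ y 1) x)
          - ∫ x, φ x 2 * pderiv 1 (fun y => ψ y 0) x) := by
  have hI := integrable_mul_pderiv hφ hψ
  rw [← integral_sub (hI 0 1 2) (hI 0 2 1), ← integral_sub (hI 1 2 0) (hI 1 0 2),
    ← integral_sub (hI 2 0 1) (hI 2 1 0),
    ← integral_add, ← integral_add]
  rotate_left
  · exact ((hI 0 1 2).sub (hI 0 2 1)).add ((hI 1 2 0).sub (hI 1 0 2))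
  · exact (hI 2 0 1).sub (hI 2 1 0)
  · exact (hI 0 1 2).sub (hI 0 2 1)
  · exact (hI 1 2 0).sub (hI 1 0 2)
  congr 1
  funext x
  simp [PiLp.inner_apply, Fin.sum_univ_three, vcurl]
  ring

lemma setIntegral_test {D : Opens E3} {φ : E3 → E3} (hφ : IsTestField D φ) (g : E3 → E3) :
    ∫ x in (D : Set E3), inner ℝ (φ x) (g x) = ∫ x, inner ℝ (φ x) (g x) := by
  apply setIntegral_eq_integral_of_forall_compl_eq_zero
  intro x hx
  have : φ x = 0 := image_eq_zero_of_notMem_tsupport fun h => hx (hφ.support_subset h)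
  simp [this]

/-- The curl is formally self-adjoint on test fields. -/
lemma isWeakCurl_test {D : Opens E3} {φ : E3 → E3} (hφ : IsTestField D φ) :
    IsWeakCurl D hφ.memLp.toLp hφ.vcurl.memLp.toLp := by
  intro ψ hψ
  have e1 : ∫ x in (D : Set E3), inner ℝ ((hφ.memLp.toLp : L2 D) x) (vcurl ψ x)
      = ∫ x in (D : Set E3), inner ℝ (φ x) (vcurl ψ x) := by
    apply integral_congr_ae
    filter_upwards [hφ.memLp.coeFn_toLp] with x hx
    rw [hx]
  have e2 : ∫ x in (D : Set E3), inner ℝ ((hφ.vcurl.memLp.toLp : L2 D) x) (ψ x)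
      = ∫ x in (D : Set E3), inner ℝ (ψ x) (vcurl φ x) := by
    apply integral_congr_ae
    filter_upwards [hφ.vcurl.memLp.coeFn_toLp] with x hx
    rw [hx, real_inner_comm]
  rw [e1, e2, setIntegral_test hφ, setIntegral_test hψ, integral_inner_vcurl hφ hψ,
    integral_inner_vcurl hψ hφ]
  have hp : ∀ i j k, ∫ x, φ x i * pderiv j (fun y => ψ y k) x
      = - ∫ x, ψ x k * pderiv j (fun y => φ y i) x := by
    intro i j k
    rw [integral_pderiv hφ hψ]
    congr 2
    funext x
    ring
  simp only [hp]
  ring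

/-- A square integrable field on `D` that is orthogonal to all test fields vanishes. -/
lemma eq_zero_of_test {D : Opens E3} {w : L2 D}
    (h : ∀ φ : E3 → E3, IsTestField D φ → ∫ x in (D : Set E3), inner ℝ (w x) (φ x) = 0) :
    w = 0 := by
  have hloc : LocallyIntegrableOn (fun x => w x) (D : Set E3) volume := by
    apply (Lp.memLp w).locallyIntegrable (by norm_num) |>.locallyIntegrableOn (D : Set E3) |>.mono_set
      subset_rfl |> fun h => ?_
    rw [locallyIntegrableOn_iff D.isOpen.isLocallyClosed] at h ⊢
    intro K hK hKc
    have := h K hK hKc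
    rwa [IntegrableOn, Measure.restrict_restrict hKc.measurableSet,
      Set.inter_eq_left.2 hK] at this
  have hcomp : ∀ i : Fin 3, ∀ᵐ x ∂volume, x ∈ (D : Set E3) → w x i = 0 := by
    intro i
    refine D.isOpen.ae_eq_zero_of_integral_contDiff_smul_eq_zero (f := fun x => w x i) ?_ ?_
    · rw [locallyIntegrableOn_iff D.isOpen.isLocallyClosed] at hloc ⊢
      intro K hK hKc
      exact (EuclideanSpace.proj i : E3 →L[ℝ] ℝ).integrable_comp
        (hloc K hK hKc)
    · intro g hg hgc hgs
      have ht : IsTestField D (fun x => g x • EuclideanSpace.single i (1 : ℝ)) :=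
        { smooth := hg.smul contDiff_const
          compact := hgc.smul_right
          support_subset := (tsupport_smul_subset_left g _).trans hgs }
      have := h _ ht
      rw [← this, ← setIntegral_eq_integral_of_forall_compl_eq_zero (s := (D : Set E3))]
      · congr 1
        funext x
        simp [inner_smul_right, EuclideanSpace.inner_single_right]
      · intro x hx
        have : g x = 0 := image_eq_zero_of_notMem_tsupport fun h => hx (hgs h)
        simp [this]
  apply Lp.ext
  filter_upwards [Lp.coeFn_zero E3 2 (volume.restrict (D : Set E3)),
    (ae_restrict_iff' D.isOpen.measurableSet).2 (hcomp 0),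
    (ae_restrict_iff' D.isOpen.measurableSet).2 (hcomp 1),
    (ae_restrict_iff' D.isOpen.measurableSet).2 (hcomp 2)] with x h h0 h1 h2
  rw [h]
  ext i
  fin_cases i <;> simp [h0, h1, h2]

lemma IsWeakCurlCurl.unique {D : Opens E3} {u w w' : L2 D} (h : IsWeakCurlCurl D u w)
    (h' : IsWeakCurlCurl D u w') : w = w' := by
  rw [← sub_eq_zero]
  apply eq_zero_of_test
  intro φ hφ
  rw [hφ.integral_eq, inner_sub_left, ← isWeakCurlCurl_iff.1 h φ hφ,
    ← isWeakCurlCurl_iff.1 h' φ hφ, sub_self]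

lemma IsWeakCurlCurl.add {D : Opens E3} {u u' w w' : L2 D} (h : IsWeakCurlCurl D u w)
    (h' : IsWeakCurlCurl D u' w') : IsWeakCurlCurl D (u + u') (w + w') := by
  rw [isWeakCurlCurl_iff] at *
  intro φ hφ
  rw [inner_add_left, inner_add_left, h φ hφ, h' φ hφ]

lemma IsWeakCurlCurl.smul {D : Opens E3} {u w : L2 D} (c : ℝ) (h : IsWeakCurlCurl D u w) :
    IsWeakCurlCurl D (c • u) (c • w) := by
  rw [isWeakCurlCurl_iff] at *
  intro φ hφ
  rw [inner_smul_left, inner_smul_left, h φ hφ]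

lemma IsWeakCurl.add {D : Opens E3} {u u' v v' : L2 D} (h : IsWeakCurl D u v)
    (h' : IsWeakCurl D u' v') : IsWeakCurl D (u + u') (v + v') := by
  rw [isWeakCurl_iff] at *
  intro φ hφ
  rw [inner_add_left, inner_add_left, h φ hφ, h' φ hφ]

lemma IsWeakCurl.smul {D : Opens E3} {u v : L2 D} (c : ℝ) (h : IsWeakCurl D u v) :
    IsWeakCurl D (c • u) (c • v) := by
  rw [isWeakCurl_iff] at *
  intro φ hφ
  rw [inner_smul_left, inner_smul_left, h φ hφ]

lemma IsWeakCurl.curlCurl {D : Opens E3} {u v w : L2 D} (h : IsWeakCurl D u v)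
    (h' : IsWeakCurl D v w) : IsWeakCurlCurl D u w := by
  intro φ hφ
  rw [h _ hφ.vcurl, h' φ hφ]

lemma isWeakCurl_zero (D : Opens E3) : IsWeakCurl D 0 0 := by
  rw [isWeakCurl_iff]
  intro φ hφ
  simp

/-! ### The spaces `H(curl)`, `H₀(curl)` and the curl operators -/

/-- `H(curl, D)`: the square integrable fields whose distributional curl is square integrable. -/
def Hcurl (D : Opens E3) : Submodule ℝ (L2 D) where
  carrier := {u | ∃ v, IsWeakCurl D u v}
  add_mem' := fun ⟨v, h⟩ ⟨v', h'⟩ => ⟨v + v', h.add h'⟩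
  zero_mem' := ⟨0, isWeakCurl_zero D⟩
  smul_mem' := fun c _ ⟨v, h⟩ => ⟨c • v, h.smul c⟩

/-- The graph of the curl on the smooth fields with compact support in `D`. -/
def testGraph (D : Opens E3) : Submodule ℝ (L2 D × L2 D) where
  carrier := {p | ∃ φ : E3 → E3, IsTestField D φ ∧
    p.1 =ᵐ[volume.restrict (D : Set E3)] φ ∧ p.2 =ᵐ[volume.restrict (D : Set E3)] vcurl φ}
  add_mem' := by
    rintro p q ⟨φ, hφ, h1, h2⟩ ⟨ψ, hψ, h3, h4⟩
    refine ⟨φ + ψ, hφ.add hψ, ?_, ?_⟩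
    · exact (Lp.coeFn_add p.1 q.1).trans (h1.add h3)
    · rw [vcurl_add hφ.smooth hψ.smooth]
      exact (Lp.coeFn_add p.2 q.2).trans (h2.add h4)
  zero_mem' := by
    refine ⟨0, IsTestField.zero D, Lp.coeFn_zero _ _ _, ?_⟩
    have h : vcurl 0 = 0 := by
      have := vcurl_smul (φ := (0 : E3 → E3)) 0 contDiff_const
      simpa using this
    rw [h]
    exact Lp.coeFn_zero _ _ _
  smul_mem' := by
    rintro c p ⟨φ, hφ, h1, h2⟩
    refine ⟨c • φ, hφ.smul c, ?_, ?_⟩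
    · exact (Lp.coeFn_smul c p.1).trans (h1.const_smul c)
    · rw [vcurl_smul c hφ.smooth]
      exact (Lp.coeFn_smul c p.2).trans (h2.const_smul c)

/-- `H₀(curl, D)`: the closure of the smooth compactly supported fields in the graph norm of the
curl. (The closure of the graph in `L² × L²` is projected to its first component.) -/
def H0curl (D : Opens E3) : Submodule ℝ (L2 D) :=
  (testGraph D).topologicalClosure.map (LinearMap.fst ℝ (L2 D) (L2 D))

/-- A curl operator: a closed linear operator in `L²(D)` that extends the curl defined on the
smooth vector fields with compact support in `D`. -/
def IsCurlOperator (D : Opens E3) (R : L2 D →ₗ.[ℝ] L2 D) : Prop :=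
  R.IsClosed ∧ testGraph D ≤ R.graph

/-! ### The operator `T⁰` -/

lemma isWeakCurl_of_mem_closure {D : Opens E3} {p : L2 D × L2 D}
    (hp : p ∈ (testGraph D).topologicalClosure) : IsWeakCurl D p.1 p.2 := by
  have hcl : IsClosed {p : L2 D × L2 D | IsWeakCurl D p.1 p.2} := by
    have : {p : L2 D × L2 D | IsWeakCurl D p.1 p.2} =
        ⋂ (φ : E3 → E3) (h : IsTestField D φ),
          {p | inner ℝ p.1 h.vcurl.memLp.toLp = inner ℝ p.2 h.memLp.toLp} := by
      ext p
      simp only [Set.mem_ofPred_eq, Set.mem_iInter, isWeakCurl_iff]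
    rw [this]
    exact isClosed_iInter fun φ => isClosed_iInter fun h =>
      isClosed_eq (continuous_fst.inner continuous_const) (continuous_snd.inner continuous_const)
  refine closure_minimal ?_ hcl hp
  rintro q ⟨φ, hφ, h1, h2⟩
  have e1 : q.1 = hφ.memLp.toLp := Lp.ext (h1.trans hφ.memLp.coeFn_toLp.symm)
  have e2 : q.2 = hφ.vcurl.memLp.toLp := Lp.ext (h2.trans hφ.vcurl.memLp.coeFn_toLp.symm)
  simp only [Set.mem_ofPred_eq, e1, e2]
  exact isWeakCurl_test hφ

lemma H0curl_le (D : Opens E3) : H0curl D ≤ Hcurl D := by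
  rintro u ⟨p, hp, rfl⟩
  exact ⟨p.2, isWeakCurl_of_mem_closure hp⟩

/-- `D_min = {u ∈ H₀(curl, D) : curl u ∈ H₀(curl, D)}`. -/
def Dmin (D : Opens E3) : Submodule ℝ (L2 D) where
  carrier := {u | u ∈ H0curl D ∧ ∃ v, IsWeakCurl D u v ∧ v ∈ H0curl D}
  add_mem' := fun ⟨h, v, hv, hv0⟩ ⟨h', v', hv', hv0'⟩ =>
    ⟨add_mem h h', v + v', hv.add hv', add_mem hv0 hv0'⟩
  zero_mem' := ⟨zero_mem _, 0, isWeakCurl_zero D, zero_mem _⟩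
  smul_mem' := fun c _ ⟨h, v, hv, hv0⟩ =>
    ⟨Submodule.smul_mem _ c h, c • v, hv.smul c, Submodule.smul_mem _ c hv0⟩

/-- `D_2 = {u ∈ L²(D) : curl curl u = 0}`, in the sense of distributions. -/
def D2 (D : Opens E3) : Submodule ℝ (L2 D) where
  carrier := {u | IsWeakCurlCurl D u 0}
  add_mem' := fun h h' => by simpa using IsWeakCurlCurl.add h h'
  zero_mem' := (isWeakCurl_zero D).curlCurl (isWeakCurl_zero D)
  smul_mem' := fun c _ h => by simpa using IsWeakCurlCurl.smul c h

lemma exists_weakCurlCurl {D : Opens E3} {u : L2 D} (hu : u ∈ Dmin D ⊔ D2 D) :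
    ∃ w, IsWeakCurlCurl D u w := by
  obtain ⟨a, ⟨-, v, hv, hv0⟩, b, hb, rfl⟩ := Submodule.mem_sup.1 hu
  obtain ⟨w, hw⟩ := H0curl_le D hv0
  exact ⟨w + 0, (hv.curlCurl hw).add hb⟩

/-- The operator `T⁰ u = curl curl u` with domain `D_min + D_2`. -/
def T0 (D : Opens E3) : L2 D →ₗ.[ℝ] L2 D where
  domain := Dmin D ⊔ D2 D
  toFun :=
    { toFun := fun u => (exists_weakCurlCurl u.2).choose
      map_add' := fun u u' => (exists_weakCurlCurl (u + u').2).choose_spec.unique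
        ((exists_weakCurlCurl u.2).choose_spec.add (exists_weakCurlCurl u'.2).choose_spec)
      map_smul' := fun c u => (exists_weakCurlCurl (c • u).2).choose_spec.unique
        ((exists_weakCurlCurl u.2).choose_spec.smul c) }

/-- The characterising property of the values of `T⁰`. -/
lemma T0_spec (D : Opens E3) (u : (T0 D).domain) : IsWeakCurlCurl D u (T0 D u) :=
  (exists_weakCurlCurl u.2).choose_spec

/-- The product `R S` of unbounded operators, with domain `{u ∈ D(S) : S u ∈ D(R)}`. -/
def opMul {H : Type*} [AddCommGroup H] [Module ℝ H] (R S : H →ₗ.[ℝ] H) : H →ₗ.[ℝ] H where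
  domain := (R.domain.comap S.toFun).map S.domain.subtype
  toFun :=
    { toFun := fun u => R ⟨S ⟨u.1, by
          obtain ⟨s, _, hs⟩ := u.2
          exact hs ▸ s.2⟩, by
          obtain ⟨_, s, hs, rfl⟩ := u
          exact hs⟩
      map_add' := fun u v => by
        rw [← LinearPMap.map_add]
        congr 1
        exact Subtype.ext (LinearPMap.map_add S ⟨u.1, _⟩ ⟨v.1, _⟩)
      map_smul' := fun c u => by
        rw [RingHom.id_apply, ← LinearPMap.map_smul]
        congr 1
        exact Subtype.ext (LinearPMap.map_smul S c ⟨u.1, _⟩) }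

lemma mem_opMul_domain {H : Type*} [AddCommGroup H] [Module ℝ H] (R S : H →ₗ.[ℝ] H) (u : H) :
    u ∈ (opMul R S).domain ↔ ∃ h : u ∈ S.domain, S ⟨u, h⟩ ∈ R.domain := by
  constructor
  · rintro ⟨s, hs, rfl⟩
    exact ⟨s.2, hs⟩
  · rintro ⟨h, hs⟩
    exact ⟨⟨u, h⟩, hs, rfl⟩

/-! ### The explicit series on the unit ball -/

/-- The open unit ball of three-space. -/
def unitBall : Opens E3 := ⟨Metric.ball 0 1, Metric.isOpen_ball⟩

/-- The `n`-th term (`n = 0, 1, …`) of the series `∑_{n ≥ 1} r ^ n * sin (n θ)` at `x`, where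
`(r, θ)` are the polar coordinates of the horizontal projection of `x`. -/
def seriesTerm (n : ℕ) (x : E3) : ℝ :=
  ‖(⟨x 0, x 1⟩ : ℂ)‖ ^ (n + 1) * Real.sin (((n + 1 : ℕ) : ℝ) * Complex.arg ⟨x 0, x 1⟩)

/-- The vector field `(∑_{n ≥ 1} r ^ n * sin (n θ)) e_z`. -/
def seriesField (x : E3) : E3 := EuclideanSpace.single 2 (∑' n, seriesTerm n x)

end CurlCurl

end

noncomputable section

namespace CurlCurl

/-! Everything rests on the fields `Im h(x + iy) e_z` with `h` holomorphic. By the Cauchy-Riemann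
equations the curl of such a field is `(Re h', -Im h', 0)`, which is again curl-free, so the field
lies in `D2` as soon as it is square integrable (`toLp_vertField_mem_D2`).

If `D2 D ≤ Hcurl D`, the curl is a closed operator defined on all of the closed subspace `D2 D`,
hence bounded (`exists_bound_of_D2_le`). But `h = exp (n z)` satisfies `|h'| = n |h|`, so no bound
holds for all `n` (`not_D2_le_Hcurl`). This gives the second claim. The first follows from it: a
curl operator `R` extends the curl on test fields, so `R*` acts as the distributional curl and the
domain of `R R*` lies in `Hcurl D`, whereas the domain of `T0 D` contains `D2 D`.

On the unit ball the series is `Im (z / (1 - z))`. The only singularity is at `z = 1`. There the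
square of the field is at most `|1 - z| ^ (-2)`, which is integrable because the ball is thin in the
vertical direction near `(1, 0, 0)`. The curl has size `|1 - z| ^ (-2)`; its square, integrated over
a ball of radius `ε` at distance of order `ε` from `(1, 0, 0)`, is of order `ε ^ (-4) * ε ^ 3`,
which is unbounded as `ε → 0`. -/

/-! ### Cutoffs and integration by parts against fields smooth inside the domain. -/

lemma pderiv_congr {j : Fin 3} {f g : E3 → ℝ} {x : E3} (h : f =ᶠ[nhds x] g) :
    pderiv j f x = pderiv j g x := by
  simp [pderiv, h.fderiv_eq]

lemma vcurl_congr {F G : E3 → E3} {x : E3} (h : F =ᶠ[nhds x] G) : vcurl F x = vcurl G x := by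
  have e : ∀ j k, pderiv j (fun y => F y k) x = pderiv j (fun y => G y k) x := fun j k =>
    pderiv_congr (h.mono fun y hy => by simp only [hy])
  simp only [vcurl, e]

/-- The cutoff is 1 near every point of `K`, not merely on `K`, so multiplying a field by it leaves
the curl unchanged on `K`. -/
lemma exists_cutoff {D : Opens E3} {K : Set E3} (hK : IsCompact K) (hKD : K ⊆ D) :
    ∃ χ : E3 → ℝ, ContDiff ℝ ∞ χ ∧ HasCompactSupport χ ∧ tsupport χ ⊆ D ∧
      ∀ x ∈ K, ∀ᶠ y in nhds x, χ y = 1 := by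
  obtain ⟨L, hL, hKL, hLD⟩ := exists_compact_between hK D.isOpen hKD
  obtain ⟨f, h1, h0, -⟩ := exists_contMDiffMap_one_nhds_of_subset_interior
    (n := ⊤) (modelWithCornersSelf ℝ E3) hK.isClosed hKL
  have hs : tsupport f ⊆ L := closure_minimal (fun x hx => by
    by_contra hxL
    exact hx (h0 x hxL)) hL.isClosed
  exact ⟨f, f.contMDiff.contDiff, hL.of_isClosed_subset (isClosed_tsupport _) hs, hs.trans hLD,
    fun x hx => (eventually_nhdsSet_iff_forall.1 h1) x hx⟩

/-- A field that is smooth on `D`, multiplied by a cutoff function, is a test field. -/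
lemma isTestField_cutoff {D : Opens E3} {χ : E3 → ℝ} {F : E3 → E3} (hχ : ContDiff ℝ ∞ χ)
    (hc : HasCompactSupport χ) (hs : tsupport χ ⊆ D) (hF : ContDiffOn ℝ ∞ F D) :
    IsTestField D (fun x => χ x • F x) where
  smooth := contMDiff_iff_contDiff.1 <| contMDiff_of_tsupport fun _ hx =>
    contMDiffAt_iff_contDiffAt.2 <| hχ.contDiffAt.smul (hF.contDiffAt (D.isOpen.mem_nhds (hs (tsupport_smul_subset_left χ F hx))))
  compact := hc.smul_right
  support_subset := (tsupport_smul_subset_left χ F).trans hs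

/-- Integration by parts for a field that is smooth in the interior of the domain. -/
lemma integral_inner_vcurl_of_contDiffOn {D : Opens E3} {F φ : E3 → E3}
    (hF : ContDiffOn ℝ ∞ F D) (hφ : IsTestField D φ) :
    ∫ x in (D : Set E3), inner ℝ (F x) (vcurl φ x)
      = ∫ x in (D : Set E3), inner ℝ (vcurl F x) (φ x) := by
  obtain ⟨χ, hχ, hc, hs, h1⟩ := exists_cutoff hφ.compact hφ.support_subset
  have ht := isTestField_cutoff hχ hc hs hF
  -- Both integrals only see `tsupport φ`, where the test field `χ • F` and its curl agree with `F`
  -- and its curl.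
  have key := isWeakCurl_test ht φ hφ
  have e1 : ∫ x in (D : Set E3), inner ℝ ((ht.memLp.toLp : L2 D) x) (vcurl φ x)
      = ∫ x in (D : Set E3), inner ℝ (F x) (vcurl φ x) := by
    apply integral_congr_ae
    filter_upwards [ht.memLp.coeFn_toLp] with x hx
    rw [hx]
    by_cases hxs : x ∈ tsupport φ
    · rw [(h1 x hxs).self_of_nhds, one_smul]
    · rw [image_eq_zero_of_notMem_tsupport fun h => hxs (vcurl_tsupport φ h), inner_zero_right,
        inner_zero_right]
  have e2 : ∫ x in (D : Set E3), inner ℝ ((ht.vcurl.memLp.toLp : L2 D) x) (φ x)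
      = ∫ x in (D : Set E3), inner ℝ (vcurl F x) (φ x) := by
    apply integral_congr_ae
    filter_upwards [ht.vcurl.memLp.coeFn_toLp] with x hx
    rw [hx]
    by_cases hxs : x ∈ tsupport φ
    · rw [vcurl_congr (G := F) ((h1 x hxs).mono fun y hy => by simp [hy])]
    · rw [image_eq_zero_of_notMem_tsupport hxs, inner_zero_right, inner_zero_right]
  rw [← e1, ← e2, key]

/-! ### Vertical fields built from holomorphic functions -/

/-- The horizontal projection of three-space onto the complex plane. -/
def horiz : E3 →L[ℝ] ℂ :=
  Complex.ofRealCLM.comp (EuclideanSpace.proj 0) +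
    Complex.I • Complex.ofRealCLM.comp (EuclideanSpace.proj 1)

lemma horiz_apply (x : E3) : horiz x = ⟨x 0, x 1⟩ := by
  apply Complex.ext <;> simp [horiz]

/-- The vertical field whose height is the imaginary part of `h`. -/
def vertField (h : ℂ → ℂ) (x : E3) : E3 := EuclideanSpace.single 2 (h (horiz x)).im

/-- The horizontal field `(Re h, -Im h, 0)`. -/
def horizField (h : ℂ → ℂ) (x : E3) : E3 := !₂[(h (horiz x)).re, -(h (horiz x)).im, 0]

lemma norm_vertField_le (h : ℂ → ℂ) (x : E3) : ‖vertField h x‖ ≤ ‖h (horiz x)‖ := by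
  simpa [vertField] using Complex.abs_im_le_norm (h (horiz x))

lemma norm_horizField (h : ℂ → ℂ) (x : E3) : ‖horizField h x‖ = ‖h (horiz x)‖ := by
  rw [EuclideanSpace.norm_eq, Complex.norm_eq_sqrt_sq_add_sq]
  simp [horizField, Fin.sum_univ_three]

/-- Keeping `L` general serves the real part, the imaginary part and its negative at once. -/
lemma pderiv_clm_comp {h : ℂ → ℂ} {h' : ℂ} {x : E3} (L : ℂ →L[ℝ] ℝ)
    (hh : HasDerivAt h h' (horiz x)) (j : Fin 3) :
    pderiv j (fun y => L (h (horiz y))) x = L (h' * horiz (EuclideanSpace.single j 1)) := by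
  have h1 : HasFDerivAt (fun y => L (h (horiz y))) _ x :=
    L.hasFDerivAt.comp x ((hh.hasFDerivAt.restrictScalars ℝ).comp x horiz.hasFDerivAt)
  rw [pderiv, h1.fderiv]
  simp [mul_comm]

lemma horiz_single (j : Fin 3) :
    horiz (EuclideanSpace.single j 1) = ![1, Complex.I, 0] j := by
  fin_cases j <;> apply Complex.ext <;> simp [horiz_apply]

/-- The horizontal partial derivatives of `h ∘ horiz` are `h'` and `i h'`, and `Im (i h') = Re h'`.
-/
lemma vcurl_vertField {h : ℂ → ℂ} {h' : ℂ} {x : E3} (hh : HasDerivAt h h' (horiz x)) :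
    vcurl (vertField h) x = !₂[h'.re, -h'.im, 0] := by
  have e : ∀ j, pderiv j (fun y => (h (horiz y)).im) x = _ := pderiv_clm_comp Complex.imCLM hh
  have z : ∀ j, pderiv j (fun _ => (0 : ℝ)) x = 0 := fun j => by simp [pderiv]
  ext i
  fin_cases i <;> simp [vcurl, vertField, e, z, horiz_single]

/-- The only component not trivially zero is `-Im h' - Re (i h')`, which vanishes by Cauchy-Riemann.
-/
lemma vcurl_horizField {h : ℂ → ℂ} {h' : ℂ} {x : E3} (hh : HasDerivAt h h' (horiz x)) :
    vcurl (horizField h) x = 0 := by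
  have e : ∀ j, pderiv j (fun y => (h (horiz y)).re) x = _ := pderiv_clm_comp Complex.reCLM hh
  have e' : ∀ j, pderiv j (fun y => -(h (horiz y)).im) x = _ :=
    pderiv_clm_comp (-Complex.imCLM) hh
  have z : ∀ j, pderiv j (fun _ => (0 : ℝ)) x = 0 := fun j => by simp [pderiv]
  ext i
  fin_cases i <;> simp [vcurl, horizField, e, e', z, horiz_single]

lemma contDiffOn_comp_horiz {h : ℂ → ℂ} {U : Set ℂ} (hU : IsOpen U) (hh : DifferentiableOn ℂ h U) :
    ContDiffOn ℝ ∞ (fun x => h (horiz x)) (horiz ⁻¹' U) :=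
  ((hh.contDiffOn hU).restrict_scalars ℝ).comp horiz.contDiff.contDiffOn (Set.mapsTo_preimage _ _)

lemma contDiffOn_vertField {h : ℂ → ℂ} {U : Set ℂ} (hU : IsOpen U) (hh : DifferentiableOn ℂ h U) :
    ContDiffOn ℝ ∞ (vertField h) (horiz ⁻¹' U) := by
  rw [contDiffOn_euclidean]
  have := Complex.imCLM.contDiff.comp_contDiffOn (contDiffOn_comp_horiz hU hh)
  intro i
  fin_cases i
  · simpa [vertField] using contDiffOn_const
  · simpa [vertField] using contDiffOn_const
  · simpa [vertField, Function.comp_def] using this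

lemma contDiffOn_horizField {h : ℂ → ℂ} {U : Set ℂ} (hU : IsOpen U)
    (hh : DifferentiableOn ℂ h U) : ContDiffOn ℝ ∞ (horizField h) (horiz ⁻¹' U) := by
  rw [contDiffOn_euclidean]
  have h1 := Complex.imCLM.contDiff.comp_contDiffOn (contDiffOn_comp_horiz hU hh)
  have h2 := Complex.reCLM.contDiff.comp_contDiffOn (contDiffOn_comp_horiz hU hh)
  intro i
  fin_cases i
  · simpa [horizField, Function.comp_def] using h2
  · simpa [horizField, Function.comp_def] using h1.neg
  · simpa [horizField] using contDiffOn_const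

/-! ### Distributional curls of the vertical and horizontal fields. -/

section Holomorphic

variable {D : Opens E3} {h : ℂ → ℂ} {U : Set ℂ}

lemma integral_inner_vertField (hU : IsOpen U) (hDU : (D : Set E3) ⊆ horiz ⁻¹' U)
    (hh : DifferentiableOn ℂ h U) {φ : E3 → E3} (hφ : IsTestField D φ) :
    ∫ x in (D : Set E3), inner ℝ (vertField h x) (vcurl φ x)
      = ∫ x in (D : Set E3), inner ℝ (horizField (deriv h) x) (φ x) := by
  rw [integral_inner_vcurl_of_contDiffOn ((contDiffOn_vertField hU hh).mono hDU) hφ]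
  refine setIntegral_congr_fun D.isOpen.measurableSet fun x hx => ?_
  rw [vcurl_vertField (hh.differentiableAt (hU.mem_nhds (hDU hx))).hasDerivAt, horizField]

lemma integral_inner_horizField (hU : IsOpen U) (hDU : (D : Set E3) ⊆ horiz ⁻¹' U)
    (hh : DifferentiableOn ℂ h U) {φ : E3 → E3} (hφ : IsTestField D φ) :
    ∫ x in (D : Set E3), inner ℝ (horizField h x) (vcurl φ x) = 0 := by
  rw [integral_inner_vcurl_of_contDiffOn ((contDiffOn_horizField hU hh).mono hDU) hφ]
  refine setIntegral_eq_zero_of_forall_eq_zero fun x hx => ?_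
  rw [vcurl_horizField (hh.differentiableAt (hU.mem_nhds (hDU hx))).hasDerivAt, inner_zero_left]

lemma integral_inner_toLp {F : E3 → E3} (hF : MemLp F 2 (volume.restrict (D : Set E3)))
    (ψ : E3 → E3) :
    ∫ x in (D : Set E3), inner ℝ ((hF.toLp : L2 D) x) (ψ x)
      = ∫ x in (D : Set E3), inner ℝ (F x) (ψ x) := by
  apply integral_congr_ae
  filter_upwards [hF.coeFn_toLp] with x hx
  rw [hx]

/-- Two integrations by parts against a compactly supported field. The intermediate curl need not be
square integrable on `D`, which is what allows `h = geom` on the unit ball. -/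
lemma toLp_vertField_mem_D2 (hU : IsOpen U) (hDU : (D : Set E3) ⊆ horiz ⁻¹' U)
    (hh : DifferentiableOn ℂ h U) (hL : MemLp (vertField h) 2 (volume.restrict (D : Set E3))) :
    hL.toLp ∈ D2 D := by
  intro φ hφ
  rw [integral_inner_toLp, integral_inner_vertField hU hDU hh hφ.vcurl,
    integral_inner_horizField hU hDU (hh.deriv hU) hφ]
  symm
  apply integral_eq_zero_of_ae
  filter_upwards [Lp.coeFn_zero E3 2 (volume.restrict (D : Set E3))] with x hx
  rw [hx, Pi.zero_apply, inner_zero_left, Pi.zero_apply]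

lemma isWeakCurl_toLp_vertField (hU : IsOpen U) (hDU : (D : Set E3) ⊆ horiz ⁻¹' U)
    (hh : DifferentiableOn ℂ h U) (hL : MemLp (vertField h) 2 (volume.restrict (D : Set E3)))
    (hL' : MemLp (horizField (deriv h)) 2 (volume.restrict (D : Set E3))) :
    IsWeakCurl D hL.toLp hL'.toLp := by
  intro φ hφ
  rw [integral_inner_toLp, integral_inner_toLp, integral_inner_vertField hU hDU hh hφ]

end Holomorphic

section WeakCurl

variable {D : Opens E3}

lemma IsWeakCurl.unique {u v v' : L2 D} (h : IsWeakCurl D u v) (h' : IsWeakCurl D u v') :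
    v = v' := by
  rw [← sub_eq_zero]
  apply eq_zero_of_test
  intro φ hφ
  rw [hφ.integral_eq, inner_sub_left, ← isWeakCurl_iff.1 h φ hφ, ← isWeakCurl_iff.1 h' φ hφ,
    sub_self]

/-! ### Curl operators -/

lemma IsCurlOperator.mem_graph {R : L2 D →ₗ.[ℝ] L2 D} (hR : IsCurlOperator D R) {φ : E3 → E3}
    (hφ : IsTestField D φ) : (hφ.memLp.toLp, hφ.vcurl.memLp.toLp) ∈ R.graph :=
  hR.2 ⟨φ, hφ, hφ.memLp.coeFn_toLp, hφ.vcurl.memLp.coeFn_toLp⟩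

/-- The domain contains all test fields, and only zero is orthogonal to these. Density matters
because `LinearPMap.adjoint` takes the default value zero on its domain otherwise. -/
lemma IsCurlOperator.dense_domain {R : L2 D →ₗ.[ℝ] L2 D} (hR : IsCurlOperator D R) :
    Dense (R.domain : Set (L2 D)) := by
  rw [Submodule.dense_iff_topologicalClosure_eq_top, Submodule.topologicalClosure_eq_top_iff,
    Submodule.eq_bot_iff]
  intro w hw
  apply eq_zero_of_test
  intro φ hφ
  rw [hφ.integral_eq]
  exact Submodule.inner_left_of_mem_orthogonal
    (LinearPMap.mem_domain_of_mem_graph (hR.mem_graph hφ)) hw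

/-- The adjoint of a curl operator acts as the distributional curl. -/
lemma IsCurlOperator.isWeakCurl_adjoint {R : L2 D →ₗ.[ℝ] L2 D} (hR : IsCurlOperator D R)
    (u : R.adjoint.domain) : IsWeakCurl D u (R.adjoint u) := by
  rw [isWeakCurl_iff]
  intro φ hφ
  obtain ⟨y, hy, hRy⟩ := (LinearPMap.mem_graph_iff R).1 (hR.mem_graph hφ)
  have := LinearPMap.adjoint_isFormalAdjoint hR.dense_domain u y
  rw [hy, hRy] at this
  exact this.symm

/-- Membership in the domain of `R*` alone already provides a square integrable curl. -/
lemma IsCurlOperator.opMul_adjoint_domain_le {R : L2 D →ₗ.[ℝ] L2 D} (hR : IsCurlOperator D R) :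
    (opMul R R.adjoint).domain ≤ Hcurl D := by
  intro u hu
  obtain ⟨h, -⟩ := (mem_opMul_domain _ _ _).1 hu
  exact ⟨_, hR.isWeakCurl_adjoint ⟨u, h⟩⟩

/-! ### Harmonic fields without square integrable curl -/

lemma isClosed_isWeakCurl (D : Opens E3) : IsClosed {p : L2 D × L2 D | IsWeakCurl D p.1 p.2} := by
  simp only [isWeakCurl_iff, Set.ofPred_forall]
  exact isClosed_iInter fun φ => isClosed_iInter fun h =>
    isClosed_eq (continuous_fst.inner continuous_const) (continuous_snd.inner continuous_const)

lemma isClosed_D2 (D : Opens E3) : IsClosed (D2 D : Set (L2 D)) := by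
  have : (D2 D : Set (L2 D)) = {u | IsWeakCurlCurl D u 0} := rfl
  rw [this]
  simp only [isWeakCurlCurl_iff, Set.ofPred_forall]
  exact isClosed_iInter fun φ => isClosed_iInter fun h =>
    isClosed_eq (continuous_id.inner continuous_const) continuous_const

/-- If `D_2 ⊆ H(curl)`, then the curl is bounded on `D_2` by the closed graph theorem. -/
lemma exists_bound_of_D2_le (hle : D2 D ≤ Hcurl D) :
    ∃ C : ℝ, ∀ u ∈ D2 D, ∀ v, IsWeakCurl D u v → ‖v‖ ≤ C * ‖u‖ := by
  have hex : ∀ u : D2 D, ∃ v, IsWeakCurl D u v := fun u => hle u.2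
  choose c hc using hex
  -- The chosen curls depend linearly on the field because weak curls are unique; uniqueness also
  -- identifies the graph of `T` with a closed set below.
  let T : D2 D →ₗ[ℝ] L2 D :=
    { toFun := c
      map_add' := fun u u' => (hc (u + u')).unique ((hc u).add (hc u'))
      map_smul' := fun a u => (hc (a • u)).unique ((hc u).smul a) }
  have : CompleteSpace (D2 D) := (isClosed_D2 D).completeSpace_coe
  have hcl : IsClosed (T.graph : Set (D2 D × L2 D)) := by
    have : (T.graph : Set (D2 D × L2 D)) =
        (fun p : D2 D × L2 D => ((p.1 : L2 D), p.2)) ⁻¹' {p | IsWeakCurl D p.1 p.2} := by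
      ext p
      refine ⟨fun h => ?_, fun h => h.unique (hc p.1)⟩
      have e : p.2 = c p.1 := h
      simpa [e] using hc p.1
    rw [this]
    exact (isClosed_isWeakCurl D).preimage (by fun_prop)
  let S : D2 D →L[ℝ] L2 D := ⟨T, T.continuous_of_isClosed_graph hcl⟩
  refine ⟨‖S‖, fun u hu v hv => ?_⟩
  rw [hv.unique (hc ⟨u, hu⟩)]
  exact S.le_opNorm ⟨u, hu⟩

lemma memLp_of_continuous_of_isBounded (hD : Bornology.IsBounded (D : Set E3)) {F : E3 → E3}
    (hF : Continuous F) : MemLp F 2 (volume.restrict (D : Set E3)) := by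
  obtain ⟨C, hC⟩ := hD.isCompact_closure.exists_bound_of_continuousOn hF.continuousOn
  have : IsFiniteMeasure (volume.restrict (D : Set E3)) :=
    ⟨by simpa using hD.measure_lt_top⟩
  exact MemLp.of_bound hF.aestronglyMeasurable C
    ((ae_restrict_mem D.isOpen.measurableSet).mono fun x hx => hC x (subset_closure hx))

lemma not_D2_le_Hcurl (hD : Bornology.IsBounded (D : Set E3)) (hne : (D : Set E3).Nonempty) :
    ¬ D2 D ≤ Hcurl D := by
  intro hle
  obtain ⟨C, hC⟩ := exists_bound_of_D2_le hle
  obtain ⟨n, hn⟩ := exists_nat_gt (max C 0)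
  have hn0 : (0 : ℝ) < n := (le_max_right _ _).trans_lt hn
  have hnC : C < n := (le_max_left _ _).trans_lt hn
  let h : ℂ → ℂ := fun z => Complex.exp (n * z)
  have hd : Differentiable ℂ h := by fun_prop
  have hderiv : ∀ z, deriv h z = n * h z := fun z => by
    have : HasDerivAt h (Complex.exp (n * z) * (n * 1)) z :=
      ((hasDerivAt_id z).const_mul (n : ℂ)).cexp
    rw [this.deriv]
    simp only [h]
    ring
  have hcF : Continuous (vertField h) := by
    have := (contDiffOn_vertField isOpen_univ hd.differentiableOn).continuousOn
    rwa [Set.preimage_univ, continuousOn_univ] at this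
  have hcG : Continuous (horizField (deriv h)) := by
    have := (contDiffOn_horizField isOpen_univ
      (hd.differentiableOn.deriv isOpen_univ)).continuousOn
    rwa [Set.preimage_univ, continuousOn_univ] at this
  have hF := memLp_of_continuous_of_isBounded hD hcF
  have hG := memLp_of_continuous_of_isBounded hD hcG
  have hmem := toLp_vertField_mem_D2 isOpen_univ (Set.subset_univ _) hd.differentiableOn hF
  have hcurl := isWeakCurl_toLp_vertField isOpen_univ (Set.subset_univ _) hd.differentiableOn hF hG
  have h1 := hC _ hmem _ hcurl
  -- Pointwise `|Im h| ≤ |h| = |h'| / n`.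
  have h2 : ‖(hF.toLp : L2 D)‖ ≤ (n : ℝ)⁻¹ * ‖(hG.toLp : L2 D)‖ := by
    apply Lp.norm_le_mul_norm_of_ae_le_mul
    filter_upwards [hF.coeFn_toLp, hG.coeFn_toLp] with x hx hx'
    rw [hx, hx', norm_horizField, hderiv, norm_mul, Complex.norm_natCast,
      inv_mul_cancel_left₀ hn0.ne']
    exact norm_vertField_le h x
  -- The exponential has no zeros, and a nonempty open set has positive measure.
  have h3 : (hG.toLp : L2 D) ≠ 0 := by
    intro h0
    have hae : ∀ᵐ x ∂(volume.restrict (D : Set E3)), False := by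
      filter_upwards [hG.coeFn_toLp, Lp.coeFn_zero E3 2 (volume.restrict (D : Set E3))]
        with x hx hx'
      rw [h0, hx'] at hx
      have : ‖horizField (deriv h) x‖ = 0 := by rw [← hx, Pi.zero_apply, norm_zero]
      rw [norm_horizField, hderiv, norm_mul, Complex.norm_natCast] at this
      exact (mul_pos hn0 (norm_pos_iff.2 (Complex.exp_ne_zero _))).ne' this
    rw [Filter.eventually_false_iff_eq_bot, ae_eq_bot, Measure.restrict_eq_zero] at hae
    exact (D.isOpen.measure_pos volume hne).ne' hae
  have hpos : 0 < ‖(hG.toLp : L2 D)‖ := norm_pos_iff.2 h3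
  have h4 : (n : ℝ) * ‖(hF.toLp : L2 D)‖ ≤ ‖(hG.toLp : L2 D)‖ := by
    rwa [inv_mul_eq_div, le_div_iff₀' hn0] at h2
  have h5 : 0 < ‖(hF.toLp : L2 D)‖ := by
    refine lt_of_le_of_ne (norm_nonneg _) fun h0 => ?_
    rw [← h0, mul_zero] at h1
    exact hpos.not_ge h1
  -- With `F` the field and `G` its curl, `n ‖F‖ ≤ ‖G‖ ≤ C ‖F‖`, although `C < n` and `‖F‖ > 0`.
  nlinarith

end WeakCurl

/-! ### The series on the unit ball -/

/-- The sum `∑_{n ≥ 1} ζ ^ n` of the geometric series. -/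
def geom (z : ℂ) : ℂ := z / (1 - z)

lemma one_sub_ne_zero_of_mem {z : ℂ} (hz : z ∈ Metric.ball (0 : ℂ) 1) : 1 - z ≠ 0 := by
  rintro h
  rw [← sub_eq_zero.1 h] at hz
  simp at hz

lemma hasDerivAt_geom {z : ℂ} (hz : z ∈ Metric.ball (0 : ℂ) 1) :
    HasDerivAt geom (((1 - z) ^ 2)⁻¹) z := by
  have h := (hasDerivAt_id z).div ((hasDerivAt_id z).const_sub 1) (one_sub_ne_zero_of_mem hz)
  convert! h using 1
  simp [div_eq_inv_mul]

lemma differentiableOn_geom : DifferentiableOn ℂ geom (Metric.ball 0 1) := fun _ hz =>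
  (hasDerivAt_geom hz).differentiableAt.differentiableWithinAt

/-- De Moivre's formula. On the axis, where `Complex.arg` has a default value, both sides vanish
since the exponent is positive. -/
lemma seriesTerm_eq (n : ℕ) (x : E3) : seriesTerm n x = (horiz x ^ (n + 1)).im := by
  rw [seriesTerm, ← horiz_apply]
  conv_rhs => rw [← Complex.norm_mul_exp_arg_mul_I (horiz x), mul_pow, ← Complex.exp_nat_mul]
  rw [← Complex.ofReal_pow, Complex.im_ofReal_mul,
    show ((n + 1 : ℕ) : ℂ) * (Complex.arg (horiz x) * Complex.I)
      = ((((n + 1 : ℕ) : ℝ) * Complex.arg (horiz x) : ℝ) : ℂ) * Complex.I by push_cast; ring,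
    Complex.exp_ofReal_mul_I_im]

lemma norm_sq_eq (x : E3) : ‖x‖ ^ 2 = ‖horiz x‖ ^ 2 + x 2 ^ 2 := by
  rw [EuclideanSpace.norm_sq_eq, Complex.sq_norm, Complex.normSq_apply]
  simp [Fin.sum_univ_three, horiz_apply, sq_abs]
  ring

lemma norm_horiz_le (x : E3) : ‖horiz x‖ ≤ ‖x‖ := by
  refine (sq_le_sq₀ (norm_nonneg _) (norm_nonneg _)).1 ?_
  rw [norm_sq_eq x]
  exact le_add_of_nonneg_right (sq_nonneg _)

lemma unitBall_subset : (unitBall : Set E3) ⊆ horiz ⁻¹' Metric.ball 0 1 := fun x hx => by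
  have : ‖x‖ < 1 := by simpa [unitBall] using hx
  simpa using (norm_horiz_le x).trans_lt this

lemma hasSum_seriesTerm {x : E3} (hx : x ∈ unitBall) :
    HasSum (fun n => seriesTerm n x) (geom (horiz x)).im := by
  have h1 : ‖horiz x‖ < 1 := by simpa using unitBall_subset hx
  have h := (hasSum_geometric_of_norm_lt_one h1).mul_left (horiz x)
  simp only [seriesTerm_eq, pow_succ']
  exact Complex.hasSum_im h

lemma seriesField_eqOn : Set.EqOn seriesField (vertField geom) unitBall := fun x hx => by
  rw [seriesField, vertField, (hasSum_seriesTerm hx).tsum_eq]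

/-! ### Square integrability -/

/-- The power `|t| ^ r`, truncated to a bounded interval. -/
def truncPow (r t : ℝ) : ℝ := (Set.Ioc (-2) 2).indicator (fun t => |t| ^ r) t

lemma integrable_truncPow {r : ℝ} (hr : -1 < r) : Integrable (truncPow r) := by
  -- The complex power is used since its norm is `|t| ^ r` for negative `t` as well.
  have h := (intervalIntegral.intervalIntegrable_cpow' (a := -2) (b := 2) (r := (r : ℂ))
    (by simpa using hr)).norm
  rw [intervalIntegrable_iff_integrableOn_Ioc_of_le (by norm_num)] at h
  refine (integrable_indicator_iff measurableSet_Ioc).2 (h.congr_fun (fun t _ => ?_)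
    measurableSet_Ioc)
  simp only
  rw [Complex.norm_cpow_real, Complex.norm_real, Real.norm_eq_abs]

lemma truncPow_of_mem {r t : ℝ} (ht : t ∈ Set.Ioc (-2 : ℝ) 2) : truncPow r t = |t| ^ r :=
  Set.indicator_of_mem ht _

/-- An integrable function that dominates `1 / ((1 - x)² + y²)` on the unit ball. -/
def majorant (x : E3) : ℝ :=
  truncPow (-7 / 8) (1 - x 0) * truncPow (-3 / 4) (x 1) * truncPow (-3 / 4) (x 2)

lemma integrable_majorant : Integrable majorant := by
  have h : Integrable (fun y : Fin 3 → ℝ => ∏ i,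
      (![fun t => truncPow (-7 / 8) (1 - t), truncPow (-3 / 4), truncPow (-3 / 4)] :
        Fin 3 → ℝ → ℝ) i (y i)) (Measure.pi fun _ => volume) := by
    apply Integrable.fintype_prod
    intro i
    fin_cases i
    · exact (integrable_truncPow (by norm_num)).comp_sub_left 1
    · exact integrable_truncPow (by norm_num)
    · exact integrable_truncPow (by norm_num)
  rw [← volume_pi] at h
  have h' := (PiLp.volume_preserving_ofLp (Fin 3)).integrable_comp_of_integrable h
  refine h'.congr (Filter.Eventually.of_forall fun x => ?_)
  simp [majorant, Fin.prod_univ_three]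

/-- Since `0 ^ (-3 / 4)` is 0 for the real power, `majorant` vanishes on the plane `x 2 = 0` and
dominates nothing there; this null set has to be discarded. -/
lemma ae_apply_two_ne_zero : ∀ᵐ x : E3, x 2 ≠ 0 :=
  (PiLp.volume_preserving_ofLp (Fin 3)).quasiMeasurePreserving.ae
    (p := fun y : Fin 3 → ℝ => y 2 ≠ 0) (Measure.ae_eval_ne (μ := fun _ : Fin 3 => volume) 2 0)

/-- All three exponents are below 1, so that each factor of `majorant` is integrable. As `c` is at
most of order `s ^ (1 / 2)`, the total degree in `s` is `7/8 + 3/4 + 3/8 = 2`. With `a` and `b`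
alone, degree 2 would need an exponent of at least 1. -/
lemma rpow_mul_rpow_mul_rpow_le {a b c : ℝ} (ha : 0 ≤ a) (hb : 0 ≤ b) (hc : 0 ≤ c)
    (h : c ^ 2 ≤ 2 * a) :
    a ^ (7 / 8 : ℝ) * b ^ (3 / 4 : ℝ) * c ^ (3 / 4 : ℝ) ≤ 2 * (a ^ 2 + b ^ 2) := by
  set s := √(a ^ 2 + b ^ 2) with hs
  have hs0 : 0 ≤ s := Real.sqrt_nonneg _
  have has : a ≤ s := Real.le_sqrt_of_sq_le (by nlinarith)
  have hbs : b ≤ s := Real.le_sqrt_of_sq_le (by nlinarith)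
  have hss : s ^ 2 = a ^ 2 + b ^ 2 := Real.sq_sqrt (by positivity)
  have hc' : c ^ (3 / 4 : ℝ) ≤ 2 * s ^ (3 / 8 : ℝ) := by
    calc c ^ (3 / 4 : ℝ) = (c ^ 2) ^ (3 / 8 : ℝ) := by
          rw [← Real.rpow_natCast, ← Real.rpow_mul hc]
          norm_num
      _ ≤ (2 * s) ^ (3 / 8 : ℝ) := by gcongr; linarith
      _ = 2 ^ (3 / 8 : ℝ) * s ^ (3 / 8 : ℝ) := Real.mul_rpow (by norm_num) hs0
      _ ≤ 2 ^ (1 : ℝ) * s ^ (3 / 8 : ℝ) := by gcongr <;> norm_num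
      _ = 2 * s ^ (3 / 8 : ℝ) := by rw [Real.rpow_one]
  calc a ^ (7 / 8 : ℝ) * b ^ (3 / 4 : ℝ) * c ^ (3 / 4 : ℝ)
      ≤ s ^ (7 / 8 : ℝ) * s ^ (3 / 4 : ℝ) * (2 * s ^ (3 / 8 : ℝ)) := by gcongr
    _ = 2 * (s ^ (7 / 8 : ℝ) * s ^ (3 / 4 : ℝ) * s ^ (3 / 8 : ℝ)) := by ring
    _ = 2 * s ^ 2 := by
        rw [← Real.rpow_add_of_nonneg hs0 (by norm_num) (by norm_num),
          ← Real.rpow_add_of_nonneg hs0 (by norm_num) (by norm_num), ← Real.rpow_natCast]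
        norm_num
    _ = 2 * (a ^ 2 + b ^ 2) := by rw [hss]

lemma norm_geom_le {z : ℂ} (hz : z ∈ Metric.ball (0 : ℂ) 1) : ‖geom z‖ ≤ ‖1 - z‖⁻¹ := by
  have h : ‖z‖ < 1 := by simpa using hz
  rw [geom, norm_div, div_eq_mul_inv]
  exact mul_le_of_le_one_left (by positivity) h.le

lemma normSq_one_sub (x : E3) : ‖1 - horiz x‖ ^ 2 = (1 - x 0) ^ 2 + x 1 ^ 2 := by
  rw [Complex.sq_norm, Complex.normSq_apply]
  simp [horiz_apply]
  ring

lemma sq_norm_vertField_geom_le {x : E3} (hx : x ∈ unitBall) (h2 : x 2 ≠ 0) :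
    ‖vertField geom x‖ ^ 2 ≤ 2 * majorant x := by
  have hx1 : ‖x‖ < 1 := by simpa [unitBall] using hx
  have hsum : x 0 ^ 2 + x 1 ^ 2 + x 2 ^ 2 < 1 := by
    have := EuclideanSpace.norm_sq_eq x
    simp only [Fin.sum_univ_three, Real.norm_eq_abs, sq_abs] at this
    nlinarith [norm_nonneg x]
  have a0 : 0 < 1 - x 0 := by nlinarith
  have m0 : 1 - x 0 ∈ Set.Ioc (-2 : ℝ) 2 := ⟨by linarith, by nlinarith⟩
  have m1 : x 1 ∈ Set.Ioc (-2 : ℝ) 2 := ⟨by nlinarith, by nlinarith⟩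
  have m2 : x 2 ∈ Set.Ioc (-2 : ℝ) 2 := ⟨by nlinarith, by nlinarith⟩
  rw [majorant, truncPow_of_mem m0, truncPow_of_mem m1, truncPow_of_mem m2]
  -- For `x 1 = 0` the majorant is zero by the same convention, but `geom` is real there and the
  -- field vanishes too.
  by_cases h1 : x 1 = 0
  · have : geom (horiz x) = ((x 0 / (1 - x 0) : ℝ) : ℂ) := by
      rw [horiz_apply, h1, geom, show (⟨x 0, 0⟩ : ℂ) = ((x 0 : ℝ) : ℂ) from rfl]
      push_cast
      rfl
    have h0 : ‖vertField geom x‖ ^ 2 = 0 := by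
      rw [vertField, this, Complex.ofReal_im]
      simp
    rw [h0]
    positivity
  have hle : ‖vertField geom x‖ ^ 2 ≤ ((1 - x 0) ^ 2 + x 1 ^ 2)⁻¹ := by
    rw [← normSq_one_sub, ← inv_pow]
    gcongr
    exact (norm_vertField_le _ _).trans (norm_geom_le (unitBall_subset hx))
  refine hle.trans ?_
  -- In the ball, `x 2 ^ 2 ≤ 1 - x 0 ^ 2 = (1 - x 0) (1 + x 0) ≤ 2 (1 - x 0)`.
  have key := rpow_mul_rpow_mul_rpow_le a0.le (abs_nonneg (x 1)) (abs_nonneg (x 2))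
    (by rw [sq_abs]; nlinarith)
  rw [sq_abs] at key
  have p1 := abs_pos.2 h1
  have p2 := abs_pos.2 h2
  rw [abs_of_pos a0, neg_div, neg_div, Real.rpow_neg a0.le, Real.rpow_neg p1.le,
    Real.rpow_neg p2.le, ← mul_inv, ← mul_inv, ← div_eq_mul_inv, le_div_iff₀ (by positivity),
    inv_mul_le_iff₀ (by positivity), mul_comm _ (2 : ℝ)]
  exact key

lemma continuousOn_vertField_geom : ContinuousOn (vertField geom) unitBall :=
  (contDiffOn_vertField Metric.isOpen_ball differentiableOn_geom).continuousOn.mono unitBall_subset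

lemma memLp_vertField_geom :
    MemLp (vertField geom) 2 (volume.restrict (unitBall : Set E3)) := by
  have hm := continuousOn_vertField_geom.aestronglyMeasurable (μ := volume)
    unitBall.isOpen.measurableSet
  rw [memLp_two_iff_integrable_sq_norm hm]
  refine (integrable_majorant.const_mul 2).restrict.mono' (hm.norm.pow 2) ?_
  filter_upwards [ae_restrict_mem unitBall.isOpen.measurableSet,
    ae_restrict_of_ae ae_apply_two_ne_zero] with x hx h2
  rw [Real.norm_eq_abs, abs_of_nonneg (by positivity)]
  exact sq_norm_vertField_geom_le hx h2

/-! ### The curl is not square integrable -/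

/-- A test field on `D'` is one on `D`. This localises a hypothetical curl to small balls on which
the classical curl is bounded. -/
lemma IsWeakCurl.mono {D D' : Opens E3} (hle : (D' : Set E3) ⊆ D) {u v : L2 D}
    (h : IsWeakCurl D u v) (hu : MemLp u 2 (volume.restrict (D' : Set E3)))
    (hv : MemLp v 2 (volume.restrict (D' : Set E3))) :
    IsWeakCurl D' hu.toLp hv.toLp := by
  intro φ hφ
  rw [integral_inner_toLp, integral_inner_toLp]
  have hz : ∀ w : L2 D, ∀ ψ : E3 → E3, IsTestField D' ψ →
      ∫ x in (D' : Set E3), inner ℝ (w x) (ψ x) = ∫ x in (D : Set E3), inner ℝ (w x) (ψ x) := by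
    intro w ψ hψ
    symm
    refine setIntegral_eq_of_subset_of_forall_sdiff_eq_zero D.isOpen.measurableSet hle fun x hx => ?_
    rw [image_eq_zero_of_notMem_tsupport fun hs => hx.2 (hψ.support_subset hs), inner_zero_right]
  rw [hz u _ hφ.vcurl, hz v _ hφ]
  exact h φ ⟨hφ.smooth, hφ.compact, hφ.support_subset.trans hle⟩

lemma horizField_deriv_geom_norm {x : E3} (hx : horiz x ∈ Metric.ball (0 : ℂ) 1) :
    ‖horizField (deriv geom) x‖ = (‖1 - horiz x‖ ^ 2)⁻¹ := by
  rw [norm_horizField, (hasDerivAt_geom hx).deriv, norm_inv, norm_pow]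

/-- The ball of radius `ε` about `(1 - 2 ε, 0, 0)`. -/
def nearBall (ε : ℝ) : Opens E3 :=
  ⟨Metric.ball (EuclideanSpace.single 0 (1 - 2 * ε)) ε, Metric.isOpen_ball⟩

lemma nearBall_subset {ε : ℝ} (h0 : 0 < ε) (h1 : ε < 1 / 2) :
    (nearBall ε : Set E3) ⊆ unitBall := by
  refine Metric.ball_subset_ball' ?_
  rw [dist_zero_right, PiLp.norm_single, Real.norm_eq_abs, abs_of_pos (by linarith)]
  linarith

/-- The centre projects to `1 - 2 ε`, at distance `2 ε` from 1, and the projection moves points by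
less than `ε`. -/
lemma norm_one_sub_horiz_of_mem_nearBall {ε : ℝ} (h0 : 0 < ε) {x : E3} (hx : x ∈ nearBall ε) :
    ε ≤ ‖1 - horiz x‖ ∧ ‖1 - horiz x‖ ≤ 3 * ε := by
  have hd : ‖x - EuclideanSpace.single 0 (1 - 2 * ε)‖ < ε := by
    simpa [nearBall, dist_eq_norm] using hx
  have h1 := (norm_horiz_le _).trans_lt hd
  have e1 : horiz (EuclideanSpace.single 0 (1 - 2 * ε)) = ((1 - 2 * ε : ℝ) : ℂ) := by
    rw [horiz_apply]
    apply Complex.ext <;> simp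
  have e2 : (1 : ℂ) - horiz x = ((2 * ε : ℝ) : ℂ)
      - horiz (x - EuclideanSpace.single 0 (1 - 2 * ε)) := by
    rw [map_sub, e1]
    push_cast
    ring
  have e3 : ‖((2 * ε : ℝ) : ℂ)‖ = 2 * ε := by
    rw [Complex.norm_real, Real.norm_eq_abs, abs_of_pos (by linarith)]
  rw [e2]
  constructor
  · have := norm_sub_norm_le ((2 * ε : ℝ) : ℂ) (horiz (x - EuclideanSpace.single 0 (1 - 2 * ε)))
    linarith
  · have := norm_sub_le ((2 * ε : ℝ) : ℂ) (horiz (x - EuclideanSpace.single 0 (1 - 2 * ε)))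
    linarith

lemma volume_real_nearBall {ε : ℝ} (h0 : 0 < ε) :
    volume.real (nearBall ε : Set E3) = ε ^ 3 * volume.real (Metric.ball (0 : E3) 1) := by
  have h := Measure.addHaar_ball (volume : Measure E3) (EuclideanSpace.single 0 (1 - 2 * ε)) h0.le
  rw [finrank_euclideanSpace_fin] at h
  rw [measureReal_def, show (nearBall ε : Set E3) = Metric.ball _ ε from rfl, h, ENNReal.toReal_mul,
    ENNReal.toReal_ofReal (by positivity), measureReal_def]

/-- On `nearBall ε`, uniqueness of weak curls forces `v` to be the classical curl, of norm `|1 - z|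
^ (-2) ≥ (3 ε) ^ (-2)`. Squaring gives the factor `81 = 3 ^ 4`, and the volume of the ball
contributes `ε ^ 3`. -/
lemma integral_sq_norm_ge {u v : L2 unitBall} (hu : u =ᵐ[volume.restrict unitBall] vertField geom)
    (h : IsWeakCurl unitBall u v) {ε : ℝ} (h0 : 0 < ε) (h1 : ε < 1 / 2) :
    volume.real (Metric.ball (0 : E3) 1) / (81 * ε) ≤ ∫ x in (unitBall : Set E3), ‖v x‖ ^ 2 := by
  have hsub := nearBall_subset h0 h1
  have hμ : volume.restrict (nearBall ε : Set E3) ≤ volume.restrict (unitBall : Set E3) :=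
    Measure.restrict_mono hsub le_rfl
  have hball := hsub.trans unitBall_subset
  have : IsFiniteMeasure (volume.restrict (nearBall ε : Set E3)) :=
    ⟨by
      rw [Measure.restrict_apply_univ]
      exact Metric.isBounded_ball.measure_lt_top⟩
  have hu' : MemLp u 2 (volume.restrict (nearBall ε : Set E3)) := (Lp.memLp u).mono_measure hμ
  have hv' : MemLp v 2 (volume.restrict (nearBall ε : Set E3)) := (Lp.memLp v).mono_measure hμ
  have hF : MemLp (vertField geom) 2 (volume.restrict (nearBall ε : Set E3)) :=
    memLp_vertField_geom.mono_measure hμ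
  have hG : MemLp (horizField (deriv geom)) 2 (volume.restrict (nearBall ε : Set E3)) := by
    refine MemLp.of_bound (((contDiffOn_horizField Metric.isOpen_ball
      (differentiableOn_geom.deriv Metric.isOpen_ball)).continuousOn.mono hball).aestronglyMeasurable
        (nearBall ε).isOpen.measurableSet) ((ε ^ 2)⁻¹) ?_
    filter_upwards [ae_restrict_mem (nearBall ε).isOpen.measurableSet] with x hx
    rw [horizField_deriv_geom_norm (hball hx)]
    gcongr
    exact (norm_one_sub_horiz_of_mem_nearBall h0 hx).1
  have heq : hu'.toLp = hF.toLp :=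
    (MemLp.toLp_eq_toLp_iff _ _).2 (ae_mono hμ hu)
  have hv : hv'.toLp = hG.toLp := (h.mono hsub hu' hv').unique
    (heq ▸ isWeakCurl_toLp_vertField Metric.isOpen_ball hball differentiableOn_geom hF hG)
  have hvG : v =ᵐ[volume.restrict (nearBall ε : Set E3)] horizField (deriv geom) :=
    (MemLp.toLp_eq_toLp_iff _ _).1 hv
  have hint : IntegrableOn (fun x => ‖v x‖ ^ 2) (unitBall : Set E3) :=
    (memLp_two_iff_integrable_sq_norm (Lp.memLp v).1).1 (Lp.memLp v)
  have hGint : IntegrableOn (fun x => ‖horizField (deriv geom) x‖ ^ 2) (nearBall ε : Set E3) :=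
    (memLp_two_iff_integrable_sq_norm hG.1).1 hG
  have hlow : (((3 * ε) ^ 2)⁻¹) ^ 2 * volume.real (nearBall ε : Set E3)
      ≤ ∫ x in (nearBall ε : Set E3), ‖horizField (deriv geom) x‖ ^ 2 := by
    refine setIntegral_ge_of_const_le_real (nearBall ε).isOpen.measurableSet
      Metric.isBounded_ball.measure_lt_top.ne (fun x hx => ?_) hGint
    obtain ⟨hl, hr⟩ := norm_one_sub_horiz_of_mem_nearBall h0 hx
    rw [horizField_deriv_geom_norm (hball hx)]
    have : 0 < ‖1 - horiz x‖ := h0.trans_le hl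
    gcongr
  calc volume.real (Metric.ball (0 : E3) 1) / (81 * ε)
      = (((3 * ε) ^ 2)⁻¹) ^ 2 * volume.real (nearBall ε : Set E3) := by
        rw [volume_real_nearBall h0]
        field_simp
        ring
    _ ≤ _ := hlow
    _ = ∫ x in (nearBall ε : Set E3), ‖v x‖ ^ 2 :=
        integral_congr_ae (hvG.mono fun x hx => by simp only [hx])
    _ ≤ ∫ x in (unitBall : Set E3), ‖v x‖ ^ 2 :=
        setIntegral_mono_set hint (Filter.Eventually.of_forall fun x => by positivity)
          hsub.eventuallyLE

lemma notMem_Hcurl_of_ae_eq_vertField_geom {u : L2 unitBall}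
    (hu : u =ᵐ[volume.restrict unitBall] vertField geom) : u ∉ Hcurl unitBall := by
  rintro ⟨v, hv⟩
  set M := ∫ x in (unitBall : Set E3), ‖v x‖ ^ 2 with hM
  have hM0 : 0 ≤ M := integral_nonneg fun x => by positivity
  set c := volume.real (Metric.ball (0 : E3) 1) with hc
  have hc0 : 0 < c := by
    rw [hc, measureReal_def]
    exact ENNReal.toReal_pos (Metric.measure_ball_pos _ _ one_pos).ne'
      Metric.isBounded_ball.measure_lt_top.ne
  -- The bound `1 / 2` keeps `nearBall ε` inside the unit ball; the other makes `c / (81 ε)` exceed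
  -- `M + 1`.
  obtain ⟨ε, h0, hε⟩ : ∃ ε > 0, ε < min (1 / 2) (c / (81 * (M + 1))) :=
    exists_between (lt_min (by norm_num) (by positivity))
  have h := integral_sq_norm_ge hu hv h0 (hε.trans_le (min_le_left _ _))
  have h2 := hε.trans_le (min_le_right _ _)
  rw [div_le_iff₀ (by positivity)] at h
  rw [lt_div_iff₀ (by positivity)] at h2
  nlinarith

end CurlCurl

end

theorem mainTheorem8 :
    (∀ D : TopologicalSpace.Opens CurlCurl.E3, Bornology.IsBounded (D : Set CurlCurl.E3) →
      (D : Set CurlCurl.E3).Nonempty →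
        (¬ ∃ R : CurlCurl.L2 D →ₗ.[ℝ] CurlCurl.L2 D, CurlCurl.IsCurlOperator D R ∧
          CurlCurl.T0 D = CurlCurl.opMul R R.adjoint) ∧
        (∃ u ∈ CurlCurl.D2 D, u ∉ CurlCurl.Hcurl D)) ∧
    (∀ x ∈ CurlCurl.unitBall, Summable fun n => CurlCurl.seriesTerm n x) ∧
    (∃ h : MeasureTheory.MemLp CurlCurl.seriesField 2
        (MeasureTheory.volume.restrict (CurlCurl.unitBall : Set CurlCurl.E3)),
      h.toLp ∈ CurlCurl.D2 CurlCurl.unitBall ∧ h.toLp ∉ CurlCurl.Hcurl CurlCurl.unitBall) := by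
  refine ⟨fun D hD hne => ⟨?_, Set.not_subset.1 (CurlCurl.not_D2_le_Hcurl hD hne)⟩,
    fun x hx => (CurlCurl.hasSum_seriesTerm hx).summable, ?_⟩
  · rintro ⟨R, hR, hT⟩
    -- Only domains are compared: `D2 D` lies in the domain of `T0 D`, which would be that of `R
    -- R*`.
    refine CurlCurl.not_D2_le_Hcurl hD hne (le_trans ?_ hR.opMul_adjoint_domain_le)
    rw [← hT]
    exact le_sup_right
  · have hae : CurlCurl.seriesField =ᵐ[volume.restrict (CurlCurl.unitBall : Set CurlCurl.E3)]
        CurlCurl.vertField CurlCurl.geom :=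
      (ae_restrict_mem CurlCurl.unitBall.isOpen.measurableSet).mono CurlCurl.seriesField_eqOn
    have h : MemLp CurlCurl.seriesField 2
        (volume.restrict (CurlCurl.unitBall : Set CurlCurl.E3)) :=
      (memLp_congr_ae hae).2 CurlCurl.memLp_vertField_geom
    refine ⟨h, ?_, CurlCurl.notMem_Hcurl_of_ae_eq_vertField_geom (h.coeFn_toLp.trans hae)⟩
    rw [(MemLp.toLp_eq_toLp_iff h CurlCurl.memLp_vertField_geom).2 hae]
    exact CurlCurl.toLp_vertField_mem_D2 Metric.isOpen_ball CurlCurl.unitBall_subset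
      CurlCurl.differentiableOn_geom _
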